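/- Let $d\ge 2$, let $B_d$ be the open unit ball of $\mathbb{C}^d$, $S_d=\partial B_d$, $\mathbb{D}$ the open unit disk, $\mathbb{T}=\partial\mathbb{D}$, and $\langle z,\zeta\rangle=\sum_{j=1}^d z_j\overline{\zeta_j}$. For $z,\zeta\in B_d\cup S_d$ with $\langle z,\zeta\rangle\ne 1$ put $$C(z,\zeta)=\frac{1}{(1-\langle z,\zeta\rangle)^d},\qquad P(z,\zeta)=\left(\frac{1-|z|^2}{|1-\langle z,\zeta\rangle|^2}\right)^d.$$ Let $\varphi:B_d\to\mathbb{D}$ be holomorphic and let $\alpha\in\mathbb{T}$. Then there is a unique finite positive Borel measure $\sigma_\alpha=\sigma_\alpha[\varphi]$ on $S_d$ (the Clark measure) such that $$\int_{S_d}P(z,\zeta)\,d\sigma_\alpha(\zeta)=\operatorname{Re}\left(\frac{\alpha+\varphi(z)}{\alpha-\varphi(z)}\right)\quad\text{for all } z\in B_d,$$ and for all $z,w\in B_d$ the function $\zeta\mapsto C(z,\zeta)C(\zeta,w)$ is $\sigma_\alpha$-integrable and $$\int_{S_d}C(z,\zeta)\,C(\zeta,w)\,d\sigma_\alpha(\zeta)=\frac{1-\varphi(z)\overline{\varphi(w)}}{\bigl(1-\overline{\alpha}\varphi(z)\bigr)\bigl(1-\alpha\overline{\varphi(w)}\bigr)}\,C(z,w).$$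 -/

import Mathlib

open MeasureTheory Metric

/-- `ℂ^d` with its Hermitian norm. Mathlib's `inner ℂ ζ z` is `∑ j, z j * conj (ζ j)`, that is
`⟨z, ζ⟩` in the convention where the form is linear in its first argument. -/
abbrev CSpace (d : ℕ) : Type := EuclideanSpace ℂ (Fin d)

/-- The Cauchy kernel `C(z, ζ) = (1 - ⟨z, ζ⟩)^(-d)` of the unit ball of `ℂ^d`. -/
noncomputable def cauchyKernel {d : ℕ} (z ζ : CSpace d) : ℂ :=
  1 / (1 - inner ℂ ζ z) ^ d

/-- The invariant Poisson kernel `P(z, ζ) = ((1 - |z|²) / |1 - ⟨z, ζ⟩|²)^d`. -/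
noncomputable def invPoissonKernel {d : ℕ} (z ζ : CSpace d) : ℝ :=
  ((1 - ‖z‖ ^ 2) / ‖1 - inner ℂ ζ z‖ ^ 2) ^ d

/-- The invariant Poisson integral `P[μ](z)` of a positive Borel measure on the unit sphere. -/
noncomputable def invPoissonIntegral {d : ℕ} (μ : Measure (sphere (0 : CSpace d) 1))
    (z : CSpace d) : ℝ :=
  ∫ ζ, invPoissonKernel z (ζ : CSpace d) ∂μ

/-- `μ` is the Clark measure `σ_α[φ]`: a finite positive Borel measure on the unit sphere whose
invariant Poisson integral is `Re ((α + φ) / (α - φ))` in the open unit ball. -/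
structure IsClarkMeasure {d : ℕ} (φ : CSpace d → ℂ) (α : ℂ)
    (μ : Measure (sphere (0 : CSpace d) 1)) : Prop where
  finite : IsFiniteMeasure μ
  poisson : ∀ z ∈ ball (0 : CSpace d) 1,
    invPoissonIntegral μ z = ((α + φ z) / (α - φ z)).re

open scoped ComplexConjugate

/-! ### Unitary maps and an invariant probability measure on the sphere -/

section

variable {V : Type*} [NormedAddCommGroup V] [InnerProductSpace ℂ V] [FiniteDimensional ℂ V]

/-! Put `F = (α + φ) / (α - φ)`, holomorphic with `Re F ≥ 0`, and let `τ` be a unitarily invariant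
probability measure on the sphere. The Cauchy formula for `τ`, applied to `x ↦ F(sx) C(x, w)` with
`s < 1`, gives `∫ F(sζ) C(z, ζ) C(ζ, w) dτ = F(sz) C(z, w)`. Averaging this with its conjugate for
`z` and `w` exchanged replaces `F(sζ)` by `Re F(sζ)` and `F(sz)` by `(F(sz) + conj F(sw)) / 2`. The
positive measures `Re F(sζ) dτ` all have mass `Re F(0)`, so they have a weak limit point as `s → 1`,
and it satisfies the formula with `s = 1` (`exists_measure_integral_cauchyKernel`). On the diagonal
`C(z, ζ) C(ζ, z) = P(z, ζ) C(z, z)`, so this limit is a Clark measure; off it, algebra with `|α| =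
1` (`cayley_half_sum`) gives the stated right side.

Uniqueness holds because `P(rζ, η)` is symmetric in `ζ, η` and an approximate identity for `τ` as `r
→ 1` (`eq_of_invPoissonIntegral_eq`). The formula thus passes to every Clark measure.

The Cauchy formula itself comes from invariance alone: `integral_slice` reduces to one complex
variable, and the moments of `|⟨ζ, v⟩|²` are the reciprocals of the coefficients of `(1 - x)^(-d)`.
-/

theorem exists_unitary_smul_orthogonal (K : Submodule ℂ V) {c : ℂ} (hc : ‖c‖ = 1) :
    ∃ U : V ≃ₗᵢ[ℂ] V, ∀ x, U x = K.starProjection x + c • (x - K.starProjection x) := by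
  let A : V →ₗ[ℂ] V := K.starProjection.toLinearMap + c • (LinearMap.id - K.starProjection.toLinearMap)
  have hA : ∀ x, A x = K.starProjection x + c • (x - K.starProjection x) := fun x => rfl
  have hn : ∀ x, ‖A x‖ = ‖x‖ := by
    intro x
    have h1 : inner ℂ (K.starProjection x) (x - K.starProjection x) = 0 :=
      K.sub_starProjection_mem_orthogonal x _ (K.starProjection_apply_mem x)
    have h2 := norm_add_sq_eq_norm_sq_add_norm_sq_of_inner_eq_zero _ _ h1
    have h3 := norm_add_sq_eq_norm_sq_add_norm_sq_of_inner_eq_zero (𝕜 := ℂ) (K.starProjection x)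
      (c • (x - K.starProjection x)) (by rw [inner_smul_right, h1, mul_zero])
    rw [norm_smul, hc, one_mul] at h3
    rw [add_sub_cancel] at h2
    rw [hA]
    have := h3.trans h2.symm
    nlinarith [norm_nonneg x, norm_nonneg (K.starProjection x + c • (x - K.starProjection x))]
  exact ⟨(LinearIsometry.mk A hn).toLinearIsometryEquiv rfl, fun x => by simp [hA]⟩

theorem exists_unitary_map_eq {v w : V} (hv : ‖v‖ = 1) (hw : ‖w‖ = 1) :
    ∃ U : V ≃ₗᵢ[ℂ] V, U v = w := by
  have hv0 : v ≠ 0 := by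
    rintro rfl
    simp at hv
  let e := LinearEquiv.toSpanNonzeroSingleton ℂ V v hv0
  have he : ∀ c : ℂ, (e c : V) = c • v := fun c => rfl
  let B : (ℂ ∙ v) →ₗ[ℂ] V := (LinearMap.toSpanSingleton ℂ V w) ∘ₗ e.symm.toLinearMap
  have hB' : ∀ c : ℂ, B (e c) = c • w := by
    intro c
    change e.symm (e c) • w = c • w
    rw [LinearEquiv.symm_apply_apply]
  have hB : ∀ x, ‖B x‖ = ‖x‖ := by
    intro x
    obtain ⟨c, rfl⟩ := e.surjective x
    rw [hB', Submodule.coe_norm, he, norm_smul, norm_smul, hv, hw]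
  let L : (ℂ ∙ v) →ₗᵢ[ℂ] V := ⟨B, hB⟩
  refine ⟨L.extend.toLinearIsometryEquiv rfl, ?_⟩
  have h1 := L.extend_apply (e 1)
  rw [he, one_smul] at h1
  rw [LinearIsometry.coe_toLinearIsometryEquiv, h1]
  exact (hB' 1).trans (one_smul _ _)


variable [MeasurableSpace V] [BorelSpace V]

/-- A measure on the unit sphere that is invariant under all unitary maps. -/
def IsUnitarilyInvariant (τ : Measure (sphere (0 : V) 1)) : Prop :=
  ∀ (U : V ≃ₗᵢ[ℂ] V) (f : V → ℂ), ∫ ζ, f (U (ζ : V)) ∂τ = ∫ ζ, f (ζ : V) ∂τ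

theorem exists_isUnitarilyInvariant [Nontrivial V] :
    ∃ τ : Measure (sphere (0 : V) 1), IsProbabilityMeasure τ ∧ IsUnitarilyInvariant τ := by
  let _ : InnerProductSpace ℝ V := InnerProductSpace.complexToReal
  have : FiniteDimensional ℝ V := FiniteDimensional.complexToReal V
  let _ : MeasureSpace V := measureSpaceOfInnerProductSpace
  set τ₀ : Measure (sphere (0 : V) 1) := (volume : Measure V).toSphere with hτ₀
  have hne : NeZero τ₀ := ⟨Measure.toSphere_ne_zero _⟩
  refine ⟨(τ₀ Set.univ)⁻¹ • τ₀, inferInstance, fun U f => ?_⟩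
  rw [integral_smul_measure, integral_smul_measure]
  congr 1
  have hmem : ∀ (W : V ≃ₗᵢ[ℂ] V) (ζ : sphere (0 : V) 1), W (ζ : V) ∈ sphere (0 : V) 1 := by
    intro W ζ
    simp
  let T : sphere (0 : V) 1 ≃ₜ sphere (0 : V) 1 :=
    { toFun := fun ζ => ⟨U ζ, hmem U ζ⟩
      invFun := fun ζ => ⟨U.symm ζ, hmem U.symm ζ⟩
      left_inv := fun ζ => by simp
      right_inv := fun ζ => by simp
      continuous_toFun := by fun_prop
      continuous_invFun := by fun_prop }
  have hU : MeasurePreserving (fun x => U x) (volume : Measure V) volume := by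
    let U' : V ≃ₗᵢ[ℝ] V :=
      { U.toLinearEquiv.restrictScalars ℝ with
        norm_map' := fun x => U.norm_map x }
    exact U'.measurePreserving
  -- `toSphere` measures a set through the volume of the cone over it, and `U` carries cones to
  -- cones and preserves volume.
  have hT : MeasurePreserving T τ₀ τ₀ := by
    refine ⟨T.continuous.measurable, ?_⟩
    ext s hs
    rw [Measure.map_apply T.continuous.measurable hs, hτ₀, Measure.toSphere_apply' _ hs,
      Measure.toSphere_apply' _ (T.continuous.measurable hs)]
    congr 1
    refine Eq.trans ?_ (hU.measure_preimage_emb U.toHomeomorph.measurableEmbedding _)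
    congr 1
    ext x
    simp only [Set.mem_smul, Set.mem_image, Set.mem_preimage]
    constructor
    · rintro ⟨r, hr, y, ⟨ζ, hζ, rfl⟩, rfl⟩
      refine ⟨r, hr, _, ⟨T ζ, hζ, rfl⟩, ?_⟩
      change r • U (ζ : V) = U (r • (ζ : V))
      exact (LinearMap.map_smul_of_tower U.toLinearEquiv.toLinearMap r (ζ : V)).symm
    · rintro ⟨r, hr, y, ⟨ζ, hζ, rfl⟩, hx⟩
      refine ⟨r, hr, _, ⟨T.symm ζ, by simpa using hζ, rfl⟩, ?_⟩
      apply U.injective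
      rw [← hx]
      have h1 : U ((T.symm ζ : sphere (0 : V) 1) : V) = ζ := by
        change U (U.symm ζ) = ζ
        simp
      conv_rhs => rw [← h1]
      exact (LinearMap.map_smul_of_tower U.toLinearEquiv.toLinearMap r _)
  exact hT.integral_comp T.measurableEmbedding (fun ζ : sphere (0 : V) 1 => f ζ)

end

/-! ### Averaging over rotations that fix a direction -/

section

variable {V : Type*} [NormedAddCommGroup V] [InnerProductSpace ℂ V]

theorem norm_slice_le {v : V} (hv : ‖v‖ = 1) (x : V) {c : ℂ} (hc : ‖c‖ ≤ 1) :
    ‖inner ℂ v x • v + c • (x - inner ℂ v x • v)‖ ≤ ‖x‖ := by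
  have hvv : inner ℂ v v = (1 : ℂ) := by
    rw [inner_self_eq_norm_sq_to_K, hv]
    simp
  have h1 : inner ℂ (inner ℂ v x • v) (x - inner ℂ v x • v) = (0 : ℂ) := by
    rw [inner_smul_left, inner_sub_right, inner_smul_right, hvv]
    ring
  have h2 := norm_add_sq_eq_norm_sq_add_norm_sq_of_inner_eq_zero _ _ h1
  have h3 := norm_add_sq_eq_norm_sq_add_norm_sq_of_inner_eq_zero (𝕜 := ℂ) (inner ℂ v x • v)
    (c • (x - inner ℂ v x • v)) (by rw [inner_smul_right, h1, mul_zero])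
  rw [add_sub_cancel] at h2
  rw [norm_smul c] at h3
  have h4 : ‖c‖ * ‖x - inner ℂ v x • v‖ ≤ 1 * ‖x - inner ℂ v x • v‖ := by gcongr
  refine le_of_sq_le_sq ?_ (norm_nonneg x)
  nlinarith [norm_nonneg (x - inner ℂ v x • v), norm_nonneg c,
    mul_nonneg (norm_nonneg c) (norm_nonneg (x - inner ℂ v x • v))]

theorem exists_unitary_twist [FiniteDimensional ℂ V] {v : V} (hv : ‖v‖ = 1) {c : ℂ}
    (hc : ‖c‖ = 1) :
    ∃ U : V ≃ₗᵢ[ℂ] V, (∀ x, U x = inner ℂ v x • v + c • (x - inner ℂ v x • v)) ∧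
      (∀ x, inner ℂ v (U x) = (inner ℂ v x : ℂ)) ∧
      ∀ w, inner ℂ v w = (0 : ℂ) → ∀ x, inner ℂ w (U x) = c * (inner ℂ w x : ℂ) := by
  obtain ⟨U, hU⟩ := exists_unitary_smul_orthogonal (ℂ ∙ v) hc
  have hvv : inner ℂ v v = (1 : ℂ) := by
    rw [inner_self_eq_norm_sq_to_K, hv]
    simp
  have hU' : ∀ x, U x = inner ℂ v x • v + c • (x - inner ℂ v x • v) := by
    intro x
    rw [hU, Submodule.starProjection_unit_singleton ℂ hv]
  refine ⟨U, hU', fun x => ?_, fun w hw x => ?_⟩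
  · rw [hU', inner_add_right, inner_smul_right, inner_smul_right, inner_sub_right, inner_smul_right,
      hvv]
    ring
  · have hw' : inner ℂ w v = (0 : ℂ) := by rw [← inner_conj_symm, hw, map_zero]
    rw [hU', inner_add_right, inner_smul_right, inner_smul_right, inner_sub_right, inner_smul_right,
      hw']
    ring

theorem exists_unitary_phase [FiniteDimensional ℂ V] {c : ℂ} (hc : ‖c‖ = 1) :
    ∃ U : V ≃ₗᵢ[ℂ] V, ∀ x, U x = c • x := by
  obtain ⟨U, hU⟩ := exists_unitary_smul_orthogonal (⊥ : Submodule ℂ V) hc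
  exact ⟨U, fun x => by rw [hU]; simp⟩

theorem Continuous.integrable_sphere [FiniteDimensional ℂ V] [MeasurableSpace V] [BorelSpace V]
    {τ : Measure (sphere (0 : V) 1)} [IsFiniteMeasure τ] {f : sphere (0 : V) 1 → ℂ}
    (hf : Continuous f) : Integrable f τ := by
  have : ProperSpace V := FiniteDimensional.proper ℂ V
  exact hf.integrable_of_hasCompactSupport (HasCompactSupport.of_compactSpace f)

variable [FiniteDimensional ℂ V] [MeasurableSpace V] [BorelSpace V]
  {τ : Measure (sphere (0 : V) 1)}

/-- Rotating the complement of `v` by a phase `c` leaves `⟨ζ, v⟩`, hence the factor `ψ`, unchanged.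
Averaging over `|c| = 1` replaces `g` by its mean on a circle in the variable `c`, which is the
value at the centre `c = 0`. -/
theorem IsUnitarilyInvariant.integral_slice [IsFiniteMeasure τ] (hτ : IsUnitarilyInvariant τ)
    {g : V → ℂ} {R : ℝ} (hR : 1 < R) (hg : DifferentiableOn ℂ g (ball 0 R)) {v : V} (hv : ‖v‖ = 1)
    {ψ : ℂ → ℂ} (hψ : Continuous ψ) :
    ∫ ζ : sphere (0 : V) 1, g ζ * ψ (inner ℂ v (ζ : V)) ∂τ =
      ∫ ζ : sphere (0 : V) 1, g (inner ℂ v (ζ : V) • v) * ψ (inner ℂ v (ζ : V)) ∂τ := by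
  have : ProperSpace V := FiniteDimensional.proper ℂ V
  have hlt : ∀ (ζ : sphere (0 : V) 1) (c : ℂ), ‖c‖ ≤ 1 →
      inner ℂ v (ζ : V) • v + c • ((ζ : V) - inner ℂ v (ζ : V) • v) ∈ ball (0 : V) R := by
    intro ζ c hc
    rw [mem_ball_zero_iff]
    have := norm_slice_le hv (ζ : V) hc
    rw [norm_eq_of_mem_sphere] at this
    linarith
  let G : ℝ → sphere (0 : V) 1 → ℂ := fun θ ζ =>
    g (inner ℂ v (ζ : V) • v + circleMap 0 1 θ • ((ζ : V) - inner ℂ v (ζ : V) • v)) *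
      ψ (inner ℂ v (ζ : V))
  have hG : Continuous (Function.uncurry G) := by
    refine Continuous.mul ?_ (by fun_prop)
    refine hg.continuousOn.comp_continuous ?_ fun p => hlt _ _ (by simp)
    have := continuous_circleMap 0 1
    fun_prop
  have h1 : ∀ θ, ∫ ζ, G θ ζ ∂τ = ∫ ζ : sphere (0 : V) 1, g ζ * ψ (inner ℂ v (ζ : V)) ∂τ := by
    intro θ
    obtain ⟨U, hU, hU', -⟩ := exists_unitary_twist hv (c := circleMap 0 1 θ) (by simp)
    have := hτ U (fun x => g x * ψ (inner ℂ v x))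
    rw [← this]
    refine integral_congr_ae (.of_forall fun ζ => ?_)
    simp only [hU', G]
    rw [hU]
  have h2 : ∀ ζ : sphere (0 : V) 1, ∫ θ in (0)..(2 * Real.pi), G θ ζ =
      (2 * Real.pi : ℂ) * (g (inner ℂ v (ζ : V) • v) * ψ (inner ℂ v (ζ : V))) := by
    intro ζ
    have hd : DifferentiableOn ℂ (fun c : ℂ =>
        g (inner ℂ v (ζ : V) • v + c • ((ζ : V) - inner ℂ v (ζ : V) • v))) (closedBall 0 1) := by
      refine hg.comp (by fun_prop) fun c hc => hlt _ _ (by simpa using hc)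
    have hm := (hd.diffContOnCl_ball (c := 0) (R := |1|) (by simp)).circleAverage
    rw [Real.circleAverage_def] at hm
    simp only [zero_smul, add_zero] at hm
    simp only [G, intervalIntegral.integral_mul_const]
    rw [← hm]
    have : (Real.pi : ℂ) ≠ 0 := by exact_mod_cast Real.pi_ne_zero
    simp only [Complex.real_smul]
    push_cast
    field_simp
  have hint : Integrable (Function.uncurry G)
      ((volume.restrict (Set.uIoc 0 (2 * Real.pi))).prod τ) := by
    obtain ⟨C, hC⟩ := ((isCompact_uIcc (a := (0 : ℝ)) (b := 2 * Real.pi)).prod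
      (isCompact_univ (X := sphere (0 : V) 1))).exists_bound_of_continuousOn hG.continuousOn
    have : IsFiniteMeasure ((volume : Measure ℝ).restrict (Set.uIoc 0 (2 * Real.pi))) :=
      ⟨by simp [Set.uIoc]⟩
    refine Integrable.of_bound hG.aestronglyMeasurable C ?_
    have : ∀ᵐ θ ∂(volume.restrict (Set.uIoc 0 (2 * Real.pi))), θ ∈ Set.uIoc 0 (2 * Real.pi) :=
      ae_restrict_mem measurableSet_uIoc
    have := (Measure.quasiMeasurePreserving_fst (ν := τ)).ae this
    filter_upwards [this] with p hp
    exact hC p ⟨Set.uIoc_subset_uIcc hp, trivial⟩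
  have h3 := intervalIntegral_integral_swap hint
  simp only [h1, h2, intervalIntegral.integral_const, integral_const_mul] at h3
  have : (Real.pi : ℂ) ≠ 0 := by exact_mod_cast Real.pi_ne_zero
  refine mul_left_cancel₀ (a := (2 * Real.pi : ℂ)) (by simp) ?_
  rw [← h3]
  simp

end

/-! ### Moments on the sphere and the Cauchy formula -/

section

theorem exists_pow_mul_conj_pow_ne_one {m k : ℕ} (h : m ≠ k) :
    ∃ c : ℂ, ‖c‖ = 1 ∧ c ^ m * conj c ^ k ≠ 1 := by
  have key : ∀ {a b : ℕ}, a < b → ∃ c : ℂ, ‖c‖ = 1 ∧ c ^ b * conj c ^ a ≠ 1 := by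
    intro a b hab
    obtain ⟨j, hj, rfl⟩ : ∃ j, 0 < j ∧ b = a + j := ⟨b - a, by omega, by omega⟩
    -- The angle `π / j` makes `c ^ j = -1`; the remaining factors pair up to `|c|² = 1`.
    have hc : ‖Complex.exp ((Real.pi / j : ℝ) * Complex.I)‖ = 1 :=
      Complex.norm_exp_ofReal_mul_I _
    refine ⟨_, hc, ?_⟩
    set c := Complex.exp ((Real.pi / j : ℝ) * Complex.I) with hcdef
    have hcc : c * conj c = 1 := by
      rw [Complex.mul_conj, Complex.normSq_eq_norm_sq, hc]
      simp
    have hcj : c ^ j = -1 := by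
      rw [hcdef, ← Complex.exp_nat_mul, ← Complex.exp_pi_mul_I]
      congr 1
      have : (j : ℂ) ≠ 0 := by exact_mod_cast hj.ne'
      push_cast
      field_simp
    have : c ^ (a + j) * conj c ^ a = -1 := by
      rw [pow_add, mul_right_comm, ← mul_pow, hcc, hcj]
      simp
    rw [this]
    norm_num
  rcases lt_or_gt_of_ne h with h | h
  · obtain ⟨c, hc, hne⟩ := key h
    refine ⟨conj c, by simpa using hc, ?_⟩
    rw [Complex.conj_conj, mul_comm]
    exact hne
  · exact key h

theorem exists_hasSum_of_differentiableOn_ball {h : ℂ → ℂ} {R : ℝ} (hR : 1 < R)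
    (hh : DifferentiableOn ℂ h (ball 0 R)) :
    ∃ a : ℕ → ℂ, (Summable fun m => ‖a m‖) ∧
      ∀ x : ℂ, ‖x‖ ≤ 1 → HasSum (fun m => a m * x ^ m) (h x) := by
  -- The midpoint of `1` and `R`: the Taylor series then converges absolutely at `1`.
  let r : NNReal := ⟨(1 + R) / 2, by linarith⟩
  have hr : (1 : ℝ) < r := by
    change 1 < (1 + R) / 2
    linarith
  have hrR : (r : ℝ) < R := by
    change (1 + R) / 2 < R
    linarith
  have hp := (hh.mono (closedBall_subset_ball hrR)).hasFPowerSeriesOnBall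
    (NNReal.coe_pos.1 (by linarith))
  set p := cauchyPowerSeries h 0 r
  have hmem : ∀ x : ℂ, ‖x‖ ≤ 1 → x ∈ Metric.eball (0 : ℂ) r := by
    intro x hx
    rw [Metric.eball_coe, mem_ball_zero_iff]
    linarith
  refine ⟨p.coeff, ?_, fun x hx => ?_⟩
  · have := p.summable_norm_apply (x := 1) (Metric.eball_subset_eball hp.r_le (hmem 1 (by simp)))
    simpa using this
  · have := hp.hasSum (hmem x hx)
    simpa [mul_comm] using this

variable {V : Type*} [NormedAddCommGroup V] [InnerProductSpace ℂ V] [FiniteDimensional ℂ V]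
  [MeasurableSpace V] [BorelSpace V] {τ : Measure (sphere (0 : V) 1)}

/-- The `k`-th moment of `|⟨ζ, v⟩|²` on the unit sphere. -/
noncomputable def sphereMoment (τ : Measure (sphere (0 : V) 1)) (v : V) (k : ℕ) : ℂ :=
  ∫ ζ : sphere (0 : V) 1, inner ℂ v (ζ : V) ^ k * conj (inner ℂ v (ζ : V) : ℂ) ^ k ∂τ

theorem IsUnitarilyInvariant.integral_pow_mul_conj_pow (hτ : IsUnitarilyInvariant τ) (v : V)
    {m k : ℕ} (h : m ≠ k) :
    ∫ ζ : sphere (0 : V) 1, inner ℂ v (ζ : V) ^ m * conj (inner ℂ v (ζ : V) : ℂ) ^ k ∂τ = 0 := by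
  obtain ⟨c, hc, hne⟩ := exists_pow_mul_conj_pow_ne_one h
  obtain ⟨U, hU⟩ := exists_unitary_phase (V := V) hc
  have h1 := hτ U (fun x => inner ℂ v x ^ m * conj (inner ℂ v x : ℂ) ^ k)
  have h2 : ∀ x : V, inner ℂ v (U x) ^ m * conj (inner ℂ v (U x) : ℂ) ^ k =
      (c ^ m * conj c ^ k) * (inner ℂ v x ^ m * conj (inner ℂ v x : ℂ) ^ k) := by
    intro x
    rw [hU, inner_smul_right, map_mul, mul_pow, mul_pow]
    ring
  simp only [h2, integral_const_mul] at h1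
  exact (mul_left_eq_self₀.1 h1).resolve_left hne

theorem IsUnitarilyInvariant.sphereMoment_eq (hτ : IsUnitarilyInvariant τ) {v w : V}
    (hv : ‖v‖ = 1) (hw : ‖w‖ = 1) (k : ℕ) : sphereMoment τ v k = sphereMoment τ w k := by
  obtain ⟨U, rfl⟩ := exists_unitary_map_eq hv hw
  have h1 := hτ U (fun x => inner ℂ (U v) x ^ k * conj (inner ℂ (U v) x : ℂ) ^ k)
  simp only [LinearIsometryEquiv.inner_map_map] at h1
  exact h1

/-- A twist about `v` affects only the `w`-coordinates and multiplies the integrand by `c * conj c ^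
j`, which differs from `1` for a suitable `c`. -/
theorem IsUnitarilyInvariant.integral_mixed_eq_zero (hτ : IsUnitarilyInvariant τ) {v w : V}
    (hv : ‖v‖ = 1) (hvw : inner ℂ v w = (0 : ℂ)) (k l : ℕ) {j : ℕ} (hj : j ≠ 1) :
    ∫ ζ : sphere (0 : V) 1, inner ℂ v (ζ : V) ^ k * inner ℂ w (ζ : V) *
      (conj (inner ℂ v (ζ : V) : ℂ) ^ l * conj (inner ℂ w (ζ : V) : ℂ) ^ j) ∂τ = 0 := by
  obtain ⟨c, hc, hne⟩ := exists_pow_mul_conj_pow_ne_one hj.symm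
  obtain ⟨U, -, hU, hU'⟩ := exists_unitary_twist hv hc
  have h1 := hτ U (fun x => inner ℂ v x ^ k * inner ℂ w x *
      (conj (inner ℂ v x : ℂ) ^ l * conj (inner ℂ w x : ℂ) ^ j))
  have h2 : ∀ x : V, inner ℂ v (U x) ^ k * inner ℂ w (U x) *
      (conj (inner ℂ v (U x) : ℂ) ^ l * conj (inner ℂ w (U x) : ℂ) ^ j) =
      (c ^ 1 * conj c ^ j) * (inner ℂ v x ^ k * inner ℂ w x *
      (conj (inner ℂ v x : ℂ) ^ l * conj (inner ℂ w x : ℂ) ^ j)) := by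
    intro x
    rw [hU, hU' w hvw, map_mul, mul_pow]
    ring
  simp only [h2, integral_const_mul] at h1
  exact (mul_left_eq_self₀.1 h1).resolve_left hne

/-- Slice `⟨x, v⟩^k ⟨x, w⟩` along `u = (v + w) / √2` against `conj ⟨x, u⟩^(k + 1)`. On the line `ℂu`
this is a multiple of the moment of order `k + 1`. On the whole sphere the binomial expansion keeps
only the term `m = k`, whose coefficient is `k + 1`. -/
theorem IsUnitarilyInvariant.integral_mixed [IsFiniteMeasure τ] (hτ : IsUnitarilyInvariant τ)
    {v w : V} (hv : ‖v‖ = 1) (hw : ‖w‖ = 1) (hvw : inner ℂ v w = (0 : ℂ)) (k : ℕ) :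
    (k + 1) * ∫ ζ : sphere (0 : V) 1, inner ℂ v (ζ : V) ^ k * inner ℂ w (ζ : V) *
      (conj (inner ℂ v (ζ : V) : ℂ) ^ k * conj (inner ℂ w (ζ : V) : ℂ) ^ 1) ∂τ =
      sphereMoment τ v (k + 1) := by
  have hwv : inner ℂ w v = (0 : ℂ) := by rw [← inner_conj_symm, hvw, map_zero]
  have hvv : inner ℂ v v = (1 : ℂ) := by
    rw [inner_self_eq_norm_sq_to_K, hv]
    simp
  have hww : inner ℂ w w = (1 : ℂ) := by
    rw [inner_self_eq_norm_sq_to_K, hw]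
    simp
  obtain ⟨s, hs, hs0⟩ : ∃ s : ℝ, s ^ 2 * 2 = 1 ∧ 0 < s :=
    ⟨√(1 / 2), by rw [Real.sq_sqrt (by norm_num)]; norm_num, by positivity⟩
  have hsC : (s : ℂ) ≠ 0 := by exact_mod_cast hs0.ne'
  have hu : ‖(s : ℂ) • (v + w)‖ = 1 := by
    have h1 := norm_add_sq_eq_norm_sq_add_norm_sq_of_inner_eq_zero _ _ hvw
    rw [hv, hw] at h1
    rw [norm_smul, Complex.norm_real, Real.norm_of_nonneg hs0.le]
    have : (s * ‖v + w‖) ^ 2 = 1 := by nlinarith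
    exact (pow_eq_one_iff_of_nonneg (by positivity) two_ne_zero).1 this
  have hslice := hτ.integral_slice (g := fun x => inner ℂ v x ^ k * inner ℂ w x) one_lt_two
    (by
      have h1 : Differentiable ℂ fun x : V => (inner ℂ v x : ℂ) := (innerSL ℂ v).differentiable
      have h2 : Differentiable ℂ fun x : V => (inner ℂ w x : ℂ) := (innerSL ℂ w).differentiable
      exact ((h1.pow k).mul h2).differentiableOn)
    hu (ψ := fun x => conj x ^ (k + 1)) (by fun_prop)
  have hm := hτ.sphereMoment_eq hu hv (k + 1)
  have hR : ∀ x : V, (inner ℂ v (inner ℂ ((s : ℂ) • (v + w)) x • (s : ℂ) • (v + w)) ^ k *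
      inner ℂ w (inner ℂ ((s : ℂ) • (v + w)) x • (s : ℂ) • (v + w))) *
      conj (inner ℂ ((s : ℂ) • (v + w)) x : ℂ) ^ (k + 1) = (s : ℂ) ^ (k + 1) *
      (inner ℂ ((s : ℂ) • (v + w)) x ^ (k + 1) *
        conj (inner ℂ ((s : ℂ) • (v + w)) x : ℂ) ^ (k + 1)) := by
    intro x
    have e1 : ∀ t : ℂ, (inner ℂ v (t • (s : ℂ) • (v + w)) : ℂ) = t * s := by
      intro t
      rw [inner_smul_right, inner_smul_right, inner_add_right, hvv, hvw]
      ring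
    have e2 : ∀ t : ℂ, (inner ℂ w (t • (s : ℂ) • (v + w)) : ℂ) = t * s := by
      intro t
      rw [inner_smul_right, inner_smul_right, inner_add_right, hww, hwv]
      ring
    rw [e1, e2]
    ring
  have hL : ∀ x : V, (inner ℂ v x ^ k * inner ℂ w x) *
      conj (inner ℂ ((s : ℂ) • (v + w)) x : ℂ) ^ (k + 1) = (s : ℂ) ^ (k + 1) *
      ∑ m ∈ Finset.range (k + 2), ((k + 1).choose m : ℂ) * (inner ℂ v x ^ k * inner ℂ w x *
        (conj (inner ℂ v x : ℂ) ^ m * conj (inner ℂ w x : ℂ) ^ (k + 1 - m))) := by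
    intro x
    rw [inner_smul_left, inner_add_left, map_mul, Complex.conj_conj, map_add, mul_pow, add_pow,
      Finset.mul_sum, Finset.mul_sum, Finset.mul_sum]
    refine Finset.sum_congr rfl fun m _ => ?_
    ring
  simp only [hL, hR, integral_const_mul] at hslice
  have hslice := mul_left_cancel₀ (pow_ne_zero _ hsC) hslice
  rw [integral_finsetSum _ fun m _ => Continuous.integrable_sphere (by fun_prop)] at hslice
  simp only [integral_const_mul] at hslice
  rw [Finset.sum_eq_single k] at hslice
  · rw [← hm]
    simp only [sphereMoment]
    rw [← hslice]
    simp
  · intro m hm hmk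
    rw [hτ.integral_mixed_eq_zero hv hvw k m, mul_zero]
    have := Finset.mem_range.1 hm
    omega
  · intro h
    exact absurd (Finset.mem_range.2 (by omega)) h

/-- Insert `1 = ∑ |⟨ζ, b i⟩|²` over an orthonormal basis. After multiplication by `k + 1`, the index
`i₀` contributes `k + 1` copies of the next moment and each other index one copy, by
`integral_mixed`. -/
theorem IsUnitarilyInvariant.sphereMoment_succ [IsFiniteMeasure τ] (hτ : IsUnitarilyInvariant τ)
    {v : V} (hv : ‖v‖ = 1) (k : ℕ) :
    (k + 1) * sphereMoment τ v k =
      (k + Module.finrank ℂ V) * sphereMoment τ v (k + 1) := by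
  have hpos : 0 < Module.finrank ℂ V := by
    have : Nontrivial V := ⟨v, 0, by rintro rfl; simp at hv⟩
    exact Module.finrank_pos
  let b := stdOrthonormalBasis ℂ V
  let i₀ : Fin (Module.finrank ℂ V) := ⟨0, hpos⟩
  have hb : ∀ i, ‖b i‖ = 1 := fun i => b.orthonormal.1 i
  rw [hτ.sphereMoment_eq hv (hb i₀), hτ.sphereMoment_eq hv (hb i₀)]
  have h1 : sphereMoment τ (b i₀) k = ∑ i, ∫ ζ : sphere (0 : V) 1,
      inner ℂ (b i₀) (ζ : V) ^ k * inner ℂ (b i) (ζ : V) *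
      (conj (inner ℂ (b i₀) (ζ : V) : ℂ) ^ k * conj (inner ℂ (b i) (ζ : V) : ℂ) ^ 1) ∂τ := by
    rw [← integral_finsetSum _ fun m _ => Continuous.integrable_sphere (by fun_prop)]
    refine integral_congr_ae (.of_forall fun ζ => ?_)
    have h2 : ∑ i, (inner ℂ (b i) (ζ : V) : ℂ) * conj (inner ℂ (b i) (ζ : V) : ℂ) = 1 := by
      have h3 := b.sum_sq_norm_inner_right (ζ : V)
      rw [norm_eq_of_mem_sphere] at h3
      simp only [Complex.mul_conj, Complex.normSq_eq_norm_sq]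
      rw [← Complex.ofReal_sum, h3]
      simp
    calc _ = inner ℂ (b i₀) (ζ : V) ^ k * conj (inner ℂ (b i₀) (ζ : V) : ℂ) ^ k * 1 :=
          (mul_one _).symm
      _ = _ := by
        rw [← h2, Finset.mul_sum]
        refine Finset.sum_congr rfl fun i _ => ?_
        ring
  rw [h1, Finset.mul_sum, ← Finset.add_sum_erase _ _ (Finset.mem_univ i₀)]
  have h4 : ∀ i ∈ Finset.univ.erase i₀, (k + 1 : ℂ) * ∫ ζ : sphere (0 : V) 1,
      inner ℂ (b i₀) (ζ : V) ^ k * inner ℂ (b i) (ζ : V) *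
      (conj (inner ℂ (b i₀) (ζ : V) : ℂ) ^ k * conj (inner ℂ (b i) (ζ : V) : ℂ) ^ 1) ∂τ =
      sphereMoment τ (b i₀) (k + 1) := fun i hi =>
    hτ.integral_mixed (hb i₀) (hb i) (b.orthonormal.2 (Finset.ne_of_mem_erase hi).symm) k
  have h5 : ∫ ζ : sphere (0 : V) 1,
      inner ℂ (b i₀) (ζ : V) ^ k * inner ℂ (b i₀) (ζ : V) *
      (conj (inner ℂ (b i₀) (ζ : V) : ℂ) ^ k * conj (inner ℂ (b i₀) (ζ : V) : ℂ) ^ 1) ∂τ =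
      sphereMoment τ (b i₀) (k + 1) := by
    refine integral_congr_ae (.of_forall fun ζ => ?_)
    ring
  rw [Finset.sum_congr rfl h4, h5, Finset.sum_const, Finset.card_erase_of_mem (Finset.mem_univ _),
    Finset.card_univ, Fintype.card_fin, nsmul_eq_mul, Nat.cast_pred hpos]
  ring

/-- The binomial is the coefficient of `x^k` in `(1 - x)^(-(N + 1))`, so in the Cauchy formula it
cancels the moment exactly. -/
theorem IsUnitarilyInvariant.choose_mul_sphereMoment [IsProbabilityMeasure τ]
    (hτ : IsUnitarilyInvariant τ) {N : ℕ} (hN : Module.finrank ℂ V = N + 1)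
    {v : V} (hv : ‖v‖ = 1) (k : ℕ) : ((k + N).choose N : ℂ) * sphereMoment τ v k = 1 := by
  induction k with
  | zero => simp [sphereMoment]
  | succ k ih =>
    have h1 := hτ.sphereMoment_succ hv k
    have h2 : ((k + N).choose N : ℂ) * (k + N + 1) = ((k + 1 + N).choose N : ℂ) * (k + 1) := by
      have := Nat.choose_mul_succ_eq (k + N) N
      rw [show k + N + 1 - N = k + 1 by omega, show k + N + 1 = k + 1 + N by omega] at this
      have := congrArg (Nat.cast : ℕ → ℂ) this
      push_cast at this
      rw [← this]
      ring
    have h3 : (k + 1 : ℂ) ≠ 0 := by exact_mod_cast k.succ_ne_zero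
    refine mul_left_cancel₀ h3 ?_
    rw [hN] at h1
    push_cast at h1
    calc (k + 1 : ℂ) * (((k + 1 + N).choose N : ℂ) * sphereMoment τ v (k + 1))
        = (((k + 1 + N).choose N : ℂ) * (k + 1)) * sphereMoment τ v (k + 1) := by ring
      _ = ((k + N).choose N : ℂ) * ((k + (N + 1)) * sphereMoment τ v (k + 1)) := by
        rw [← h2]
        ring
      _ = (k + 1) * (((k + N).choose N : ℂ) * sphereMoment τ v k) := by
        rw [← h1]
        ring
      _ = (k + 1) * 1 := by rw [ih]

/-- The Cauchy formula for the unit ball. -/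
theorem IsUnitarilyInvariant.cauchy_formula [IsProbabilityMeasure τ]
    (hτ : IsUnitarilyInvariant τ) {N : ℕ} (hN : Module.finrank ℂ V = N + 1)
    {g : V → ℂ} {R : ℝ} (hR : 1 < R) (hg : DifferentiableOn ℂ g (ball 0 R)) {z : V}
    (hz : ‖z‖ < 1) :
    ∫ ζ : sphere (0 : V) 1, g ζ * (1 / (1 - inner ℂ (ζ : V) z) ^ (N + 1)) ∂τ = g z := by
  have : ProperSpace V := FiniteDimensional.proper ℂ V
  have : Nontrivial V := Module.nontrivial_of_finrank_pos (R := ℂ) (by omega)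
  obtain ⟨v, r, hv, hr0, rfl⟩ : ∃ (v : V) (r : ℝ), ‖v‖ = 1 ∧ 0 ≤ r ∧ z = (r : ℂ) • v := by
    by_cases hz0 : z = 0
    · obtain ⟨v, hv⟩ := exists_norm_eq V zero_le_one
      exact ⟨v, 0, hv, le_rfl, by simp [hz0]⟩
    · refine ⟨((‖z‖ : ℂ)⁻¹) • z, ‖z‖, ?_, norm_nonneg z, ?_⟩
      · rw [norm_smul, norm_inv, Complex.norm_real, norm_norm, inv_mul_cancel₀ (norm_ne_zero_iff.2 hz0)]
      · rw [smul_smul, mul_inv_cancel₀ (by simpa using hz0), one_smul]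
  rw [norm_smul, hv, mul_one, Complex.norm_real, Real.norm_of_nonneg hr0] at hz
  have hle : ∀ ζ : sphere (0 : V) 1, ‖(inner ℂ v (ζ : V) : ℂ)‖ ≤ 1 := by
    intro ζ
    have := norm_inner_le_norm (𝕜 := ℂ) v (ζ : V)
    rwa [hv, norm_eq_of_mem_sphere, one_mul] at this
  obtain ⟨a, ha, hsum⟩ := exists_hasSum_of_differentiableOn_ball hR (h := fun x => g (x • v))
    (hg.comp (by fun_prop) fun x hx => by
      rw [mem_ball_zero_iff] at hx ⊢
      rwa [norm_smul, hv, mul_one])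
  -- After slicing, `g` becomes its Taylor series on `ℂv`, and orthogonality of distinct powers
  -- leaves only the `k`-th term.
  have hcoef : ∀ k : ℕ, ∫ ζ : sphere (0 : V) 1, g ζ * conj (inner ℂ v (ζ : V) : ℂ) ^ k ∂τ =
      a k * sphereMoment τ v k := by
    intro k
    rw [hτ.integral_slice hR hg hv (ψ := fun x => conj x ^ k) (by fun_prop)]
    have h1 : HasSum (fun m => ∫ ζ : sphere (0 : V) 1,
        a m * (inner ℂ v (ζ : V) ^ m * conj (inner ℂ v (ζ : V) : ℂ) ^ k) ∂τ)
        (∫ ζ : sphere (0 : V) 1, g (inner ℂ v (ζ : V) • v) *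
          conj (inner ℂ v (ζ : V) : ℂ) ^ k ∂τ) := by
      refine hasSum_integral_of_dominated_convergence (fun m _ => ‖a m‖) (fun m => ?_) (fun m => ?_)
        (.of_forall fun _ => ha) (integrable_const _) (.of_forall fun ζ => ?_)
      · exact Continuous.aestronglyMeasurable (by fun_prop)
      · refine .of_forall fun ζ => ?_
        rw [norm_mul, norm_mul, norm_pow, norm_pow, RCLike.norm_conj]
        refine mul_le_of_le_one_right (norm_nonneg _) ?_
        exact mul_le_one₀ (pow_le_one₀ (norm_nonneg _) (hle ζ)) (by positivity)
          (pow_le_one₀ (norm_nonneg _) (hle ζ))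
      · have := (hsum _ (hle ζ)).mul_right (conj (inner ℂ v (ζ : V) : ℂ) ^ k)
        simpa only [mul_assoc] using this
    refine h1.unique ?_
    convert! hasSum_ite_eq k (a k * sphereMoment τ v k) using 2 with m
    rw [integral_const_mul]
    split_ifs with hmk
    · subst hmk
      rfl
    · rw [hτ.integral_pow_mul_conj_pow v hmk, mul_zero]
  have hinner : ∀ x : V, (inner ℂ x ((r : ℂ) • v) : ℂ) = r * conj (inner ℂ v x : ℂ) := by
    intro x
    rw [inner_smul_right, inner_conj_symm]
  have hgc : Continuous fun ζ : sphere (0 : V) 1 => g ζ :=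
    hg.continuousOn.comp_continuous (by fun_prop) fun ζ => by
      rw [mem_ball_zero_iff, norm_eq_of_mem_sphere]
      exact hR
  obtain ⟨C, hC⟩ := isCompact_univ.exists_bound_of_continuousOn hgc.continuousOn
  -- Expand the kernel in its negative binomial series; convergence is uniform on the sphere since
  -- `r < 1`.
  have h2 : HasSum (fun k : ℕ => ∫ ζ : sphere (0 : V) 1, (((k + N).choose N : ℂ) * (r : ℂ) ^ k) *
      (g ζ * conj (inner ℂ v (ζ : V) : ℂ) ^ k) ∂τ)
      (∫ ζ : sphere (0 : V) 1, g ζ * (1 / (1 - inner ℂ (ζ : V) ((r : ℂ) • v)) ^ (N + 1)) ∂τ) := by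
    refine hasSum_integral_of_dominated_convergence
      (fun k _ => ((k + N).choose N * r ^ k) * C) (fun m => ?_) (fun m => ?_)
      (.of_forall fun _ => ?_) (integrable_const _) (.of_forall fun ζ => ?_)
    · exact (continuous_const.mul (hgc.mul (by fun_prop))).aestronglyMeasurable
    · refine .of_forall fun ζ => ?_
      rw [norm_mul, norm_mul, norm_mul, norm_pow, norm_pow, RCLike.norm_conj, Complex.norm_natCast,
        Complex.norm_real, Real.norm_of_nonneg hr0]
      have := hC ζ trivial
      have h0 : ‖g ζ‖ * ‖(inner ℂ v (ζ : V) : ℂ)‖ ^ m ≤ C :=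
        (mul_le_of_le_one_right (norm_nonneg _) (pow_le_one₀ (norm_nonneg _) (hle ζ))).trans this
      gcongr
    · refine Summable.mul_right _ ?_
      exact (hasSum_choose_mul_geometric_of_norm_lt_one N
        (by rwa [Real.norm_of_nonneg hr0])).summable
    · have hlt : ‖(r : ℂ) * conj (inner ℂ v (ζ : V) : ℂ)‖ < 1 := by
        rw [norm_mul, RCLike.norm_conj, Complex.norm_real, Real.norm_of_nonneg hr0]
        exact (mul_le_of_le_one_right hr0 (hle ζ)).trans_lt hz
      have := (hasSum_choose_mul_geometric_of_norm_lt_one N hlt).mul_left (g ζ)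
      rw [hinner]
      refine this.congr_fun fun k => ?_
      rw [mul_pow]
      ring
  refine h2.unique ?_
  have h3 := hsum r (by rw [Complex.norm_real, Real.norm_of_nonneg hr0]; exact hz.le)
  refine h3.congr_fun fun k => ?_
  rw [integral_const_mul, hcoef]
  have := hτ.choose_mul_sphereMoment hN hv k
  linear_combination a k * (r : ℂ) ^ k * this

end

/-! ### Cauchy kernels and existence of the representing measure -/

section

variable {d : ℕ}

theorem one_sub_inner_ne_zero {V : Type*} [NormedAddCommGroup V] [InnerProductSpace ℂ V] {x y : V}
    (h : ‖x‖ * ‖y‖ < 1) : (1 - inner ℂ x y : ℂ) ≠ 0 := by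
  intro h0
  have h1 := norm_inner_le_norm (𝕜 := ℂ) x y
  rw [← sub_eq_zero.1 h0, norm_one] at h1
  linarith

theorem conj_cauchyKernel (z w : CSpace d) : conj (cauchyKernel z w) = cauchyKernel w z := by
  simp [cauchyKernel]

theorem continuous_cauchyKernel_right {z : CSpace d} (hz : ‖z‖ < 1) :
    Continuous fun ζ : sphere (0 : CSpace d) 1 => cauchyKernel z (ζ : CSpace d) := by
  unfold cauchyKernel
  refine continuous_const.div (by fun_prop) fun ζ => pow_ne_zero _ (one_sub_inner_ne_zero ?_)
  rwa [norm_eq_of_mem_sphere, one_mul]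

theorem continuous_cauchyKernel_left {w : CSpace d} (hw : ‖w‖ < 1) :
    Continuous fun ζ : sphere (0 : CSpace d) 1 => cauchyKernel (ζ : CSpace d) w := by
  simp only [← conj_cauchyKernel w]
  exact Complex.continuous_conj.comp (continuous_cauchyKernel_right hw)

/-- The factor `(1 - |z|²)^d` in the Poisson kernel is the reciprocal of `C(z, z)`. This turns the
two-kernel formula at `w = z` into a Poisson integral. -/
theorem cauchyKernel_mul_cauchyKernel {z : CSpace d} (hz : ‖z‖ < 1) (ζ : CSpace d) :
    cauchyKernel z ζ * cauchyKernel ζ z = invPoissonKernel z ζ * cauchyKernel z z := by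
  have h1 : (1 - (‖z‖ : ℂ) ^ 2) ≠ 0 := by
    have : (1 - ‖z‖ ^ 2 : ℝ) ≠ 0 := by nlinarith [norm_nonneg z]
    exact_mod_cast this
  have h2 : (1 - inner ℂ ζ z : ℂ) * (1 - inner ℂ z ζ) = (‖(1 - inner ℂ ζ z : ℂ)‖ : ℂ) ^ 2 := by
    rw [← Complex.ofReal_pow, ← Complex.normSq_eq_norm_sq, ← Complex.mul_conj]
    simp
  simp only [cauchyKernel, invPoissonKernel]
  push_cast
  rw [div_mul_div_comm, ← mul_pow, h2, inner_self_eq_norm_sq_to_K, div_pow, div_mul_div_comm,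
    mul_one, mul_one, mul_comm ((_ : ℂ) ^ d) ((1 - _) ^ d)]
  exact (div_mul_cancel_left₀ (pow_ne_zero _ h1) _).symm ▸ (one_div _)

theorem cauchyKernel_zero_left (w : CSpace d) : cauchyKernel 0 w = 1 := by
  simp [cauchyKernel]

theorem cauchyKernel_zero_right (w : CSpace d) : cauchyKernel w 0 = 1 := by
  simp [cauchyKernel]

theorem cauchyKernel_self_ne_zero {z : CSpace d} (hz : ‖z‖ < 1) : cauchyKernel z z ≠ 0 :=
  one_div_ne_zero (pow_ne_zero _ (one_sub_inner_ne_zero (by nlinarith [norm_nonneg z])))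

variable {τ : Measure (sphere (0 : CSpace d) 1)}

theorem integral_cauchyKernel_mul_holomorphic [IsProbabilityMeasure τ] (hd : 0 < d)
    (hτ : IsUnitarilyInvariant τ) {F : CSpace d → ℂ} (hF : DifferentiableOn ℂ F (ball 0 1))
    {s : ℝ} (hs0 : 0 ≤ s) (hs : s < 1) {z w : CSpace d} (hz : ‖z‖ < 1) (hw : ‖w‖ < 1) :
    ∫ ζ : sphere (0 : CSpace d) 1, F ((s : ℂ) • (ζ : CSpace d)) *
      (cauchyKernel z (ζ : CSpace d) * cauchyKernel (ζ : CSpace d) w) ∂τ =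
      F ((s : ℂ) • z) * cauchyKernel z w := by
  obtain ⟨N, rfl⟩ : ∃ N, d = N + 1 := ⟨d - 1, by omega⟩
  -- On the ball of radius `R`, the point `sx` stays in the unit ball and `C(x, w)` has no pole.
  -- With `m = max s ‖w‖ < 1`, the choice `2 / (1 + m)` lies strictly between `1` and `1 / m` (when
  -- `m > 0`).
  obtain ⟨R, hR, hRs, hRw⟩ : ∃ R : ℝ, 1 < R ∧ R * s < 1 ∧ R * ‖w‖ < 1 := by
    have hm : max s ‖w‖ < 1 := max_lt hs hw
    have hm0 : 0 ≤ max s ‖w‖ := le_max_of_le_left hs0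
    have hlt : ∀ t, 0 ≤ t → t ≤ max s ‖w‖ → 2 / (1 + max s ‖w‖) * t < 1 := by
      intro t ht0 ht
      rw [div_mul_eq_mul_div, div_lt_one (by linarith)]
      linarith
    refine ⟨2 / (1 + max s ‖w‖), ?_, hlt s hs0 (le_max_left _ _),
      hlt ‖w‖ (norm_nonneg w) (le_max_right _ _)⟩
    rw [lt_div_iff₀ (by linarith)]
    linarith
  have hg : DifferentiableOn ℂ (fun x : CSpace (N + 1) => F ((s : ℂ) • x) * cauchyKernel x w)
      (ball 0 R) := by
    refine DifferentiableOn.mul ?_ ?_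
    · refine hF.comp (by fun_prop) fun x hx => ?_
      rw [mem_ball_zero_iff] at hx ⊢
      rw [norm_smul, Complex.norm_real, Real.norm_of_nonneg hs0]
      nlinarith
    · unfold cauchyKernel
      have h1 : Differentiable ℂ fun x : CSpace (N + 1) => (inner ℂ w x : ℂ) :=
        (innerSL ℂ w).differentiable
      have h2 : Differentiable ℂ fun x : CSpace (N + 1) => (1 - inner ℂ w x : ℂ) ^ (N + 1) := by
        fun_prop
      have h3 : ∀ x ∈ ball (0 : CSpace (N + 1)) R, (1 - inner ℂ w x : ℂ) ^ (N + 1) ≠ 0 := by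
        refine fun x hx => pow_ne_zero _ (one_sub_inner_ne_zero ?_)
        rw [mem_ball_zero_iff] at hx
        nlinarith [norm_nonneg w]
      simp only [one_div]
      exact h2.differentiableOn.fun_inv h3
  rw [← hτ.cauchy_formula (N := N) (by simp) hR hg hz]
  refine integral_congr_ae (.of_forall fun ζ => ?_)
  simp only [cauchyKernel]
  ring

/-- Conjugation exchanges the arguments of `C`, so the holomorphic formula with `z` and `w`
exchanged becomes one for `conj F` with the same kernels. -/
theorem integral_cauchyKernel_mul_re [IsProbabilityMeasure τ] (hd : 0 < d)
    (hτ : IsUnitarilyInvariant τ) {F : CSpace d → ℂ} (hF : DifferentiableOn ℂ F (ball 0 1))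
    {s : ℝ} (hs0 : 0 ≤ s) (hs : s < 1) {z w : CSpace d} (hz : ‖z‖ < 1) (hw : ‖w‖ < 1) :
    ∫ ζ : sphere (0 : CSpace d) 1, ((F ((s : ℂ) • (ζ : CSpace d))).re : ℂ) *
      (cauchyKernel z (ζ : CSpace d) * cauchyKernel (ζ : CSpace d) w) ∂τ =
      (F ((s : ℂ) • z) + conj (F ((s : ℂ) • w))) / 2 * cauchyKernel z w := by
  have h1 := integral_cauchyKernel_mul_holomorphic hd hτ hF hs0 hs hz hw
  have h2 := congrArg conj (integral_cauchyKernel_mul_holomorphic hd hτ hF hs0 hs hw hz)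
  rw [← integral_conj] at h2
  simp only [map_mul, conj_cauchyKernel] at h2
  have hFc : Continuous fun ζ : sphere (0 : CSpace d) 1 => F ((s : ℂ) • (ζ : CSpace d)) :=
    hF.continuousOn.comp_continuous (by fun_prop) fun ζ => by
      rw [mem_ball_zero_iff, norm_smul, Complex.norm_real, Real.norm_of_nonneg hs0,
        norm_eq_of_mem_sphere, mul_one]
      exact hs
  have hz1 := continuous_cauchyKernel_right hz
  have hw1 := continuous_cauchyKernel_left hw
  have i1 := Continuous.integrable_sphere (τ := τ) (hFc.mul (hz1.mul hw1))
  have i2 := Continuous.integrable_sphere (τ := τ)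
    ((Complex.continuous_conj.comp hFc).mul (hw1.mul hz1))
  calc _ = ∫ ζ : sphere (0 : CSpace d) 1, ((F ((s : ℂ) • (ζ : CSpace d)) *
          (cauchyKernel z (ζ : CSpace d) * cauchyKernel (ζ : CSpace d) w)) +
          (conj (F ((s : ℂ) • (ζ : CSpace d))) *
          (cauchyKernel (ζ : CSpace d) w * cauchyKernel z (ζ : CSpace d)))) / 2 ∂τ := by
        refine integral_congr_ae (.of_forall fun ζ => ?_)
        simp only [Complex.re_eq_add_conj]
        ring
    _ = _ := by
      rw [integral_div]
      refine (congrArg (· / 2) (integral_add i1 i2)).trans ?_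
      refine (congrArg (· / 2) (congrArg₂ (· + ·) h1 h2)).trans ?_
      ring

theorem exists_seq_tendsto_one : ∃ s : ℕ → ℝ, (∀ n, 0 ≤ s n) ∧ (∀ n, s n < 1) ∧
    Filter.Tendsto s Filter.atTop (nhds 1) := by
  let s : ℕ → ℝ := fun n => 1 - 1 / ((n : ℝ) + 1)
  have hs0 : ∀ n, 0 ≤ s n := fun n => by
    have : (1 : ℝ) / (n + 1) ≤ 1 := by
      rw [div_le_one (by positivity)]
      linarith [n.cast_nonneg (α := ℝ)]
    simp only [s]
    linarith
  have hs1 : ∀ n, s n < 1 := fun n => by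
    have : (0 : ℝ) < 1 / (n + 1) := by positivity
    simp only [s]
    linarith
  have hs : Filter.Tendsto s Filter.atTop (nhds 1) := by
    simpa [s] using (tendsto_one_div_add_atTop_nhds_zero_nat (𝕜 := ℝ)).const_sub 1
  exact ⟨s, hs0, hs1, hs⟩

/-- A holomorphic function with nonnegative real part on the ball is represented by a measure
on the sphere. -/
theorem exists_measure_integral_cauchyKernel (hd : 0 < d) {F : CSpace d → ℂ}
    (hF : DifferentiableOn ℂ F (ball 0 1)) (hF0 : ∀ z ∈ ball (0 : CSpace d) 1, 0 ≤ (F z).re) :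
    ∃ σ : Measure (sphere (0 : CSpace d) 1), IsFiniteMeasure σ ∧
      ∀ z ∈ ball (0 : CSpace d) 1, ∀ w ∈ ball (0 : CSpace d) 1,
        ∫ ζ : sphere (0 : CSpace d) 1,
          cauchyKernel z (ζ : CSpace d) * cauchyKernel (ζ : CSpace d) w ∂σ =
          (F z + conj (F w)) / 2 * cauchyKernel z w := by
  have : Nonempty (Fin d) := ⟨⟨0, hd⟩⟩
  obtain ⟨τ, hτp, hτ⟩ := exists_isUnitarilyInvariant (V := CSpace d)
  obtain ⟨s, hs0, hs1, hs⟩ := exists_seq_tendsto_one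
  have hsmem : ∀ n (ζ : sphere (0 : CSpace d) 1), (s n : ℂ) • (ζ : CSpace d) ∈ ball (0 : CSpace d) 1 := by
    intro n ζ
    rw [mem_ball_zero_iff, norm_smul, Complex.norm_real, Real.norm_of_nonneg (hs0 n),
      norm_eq_of_mem_sphere, mul_one]
    exact hs1 n
  let u : ℕ → sphere (0 : CSpace d) 1 → NNReal := fun n ζ =>
    (F ((s n : ℂ) • (ζ : CSpace d))).re.toNNReal
  have huc : ∀ n, Continuous (u n) := fun n =>
    continuous_real_toNNReal.comp (Complex.continuous_re.comp
      (hF.continuousOn.comp_continuous (by fun_prop) (hsmem n)))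
  have hucoe : ∀ n ζ, ((u n ζ : ℝ) : ℂ) = ((F ((s n : ℂ) • (ζ : CSpace d))).re : ℂ) := by
    intro n ζ
    simp only [u]
    rw [Real.coe_toNNReal _ (hF0 _ (hsmem n ζ))]
  have hufin : ∀ n, IsFiniteMeasure (τ.withDensity fun ζ => (u n ζ : ENNReal)) := by
    intro n
    obtain ⟨C, hC⟩ := isCompact_univ.bddAbove_image (huc n).continuousOn
    refine isFiniteMeasure_withDensity (ne_top_of_le_ne_top (b := ((C : NNReal) : ENNReal)) (by simp) ?_)
    calc _ ≤ ∫⁻ _, (C : ENNReal) ∂τ := lintegral_mono fun ζ =>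
            ENNReal.coe_le_coe.2 (hC ⟨ζ, trivial, rfl⟩)
      _ = _ := by simp
  let ν : ℕ → FiniteMeasure (sphere (0 : CSpace d) 1) := fun n => ⟨_, hufin n⟩
  have hint : ∀ n, ∀ f : sphere (0 : CSpace d) 1 → ℂ, ∫ ζ, f ζ ∂(ν n : Measure _) =
      ∫ ζ : sphere (0 : CSpace d) 1, ((F ((s n : ℂ) • (ζ : CSpace d))).re : ℂ) * f ζ ∂τ := by
    intro n f
    simp only [ν, FiniteMeasure.toMeasure_mk]
    rw [integral_withDensity_eq_integral_smul (huc n).measurable]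
    refine integral_congr_ae (.of_forall fun ζ => ?_)
    simp only [NNReal.smul_def, Complex.real_smul, hucoe]
  have hkey : ∀ n, ∀ z ∈ ball (0 : CSpace d) 1, ∀ w ∈ ball (0 : CSpace d) 1,
        ∫ ζ : sphere (0 : CSpace d) 1,
          cauchyKernel z (ζ : CSpace d) * cauchyKernel (ζ : CSpace d) w ∂(ν n : Measure _) =
          (F ((s n : ℂ) • z) + conj (F ((s n : ℂ) • w))) / 2 * cauchyKernel z w := by
    intro n z hz w hw
    rw [hint]
    exact integral_cauchyKernel_mul_re hd hτ hF (hs0 n) (hs1 n) (mem_ball_zero_iff.1 hz)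
      (mem_ball_zero_iff.1 hw)
  -- At `z = w = 0` both kernels are `1`, so every mass equals `Re F(0)`.
  have hmass : ∀ n, (ν n).mass ≤ (F 0).re.toNNReal := by
    intro n
    have h1 := hkey n 0 (by simp) 0 (by simp)
    simp only [cauchyKernel_zero_left, cauchyKernel_zero_right, smul_zero, mul_one,
      integral_const, Complex.add_conj] at h1
    have h2 : ((ν n : Measure (sphere (0 : CSpace d) 1)).real Set.univ) = (F 0).re := by
      have := congrArg Complex.re h1
      simpa using this
    rw [← NNReal.coe_le_coe, Real.coe_toNNReal _ (hF0 0 (by simp)), ← h2]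
    exact le_of_eq rfl
  -- Measures of bounded mass on a compact space form a weakly compact set, so convergence along an
  -- ultrafilter replaces passing to a subsequence.
  obtain ⟨σ, -, hσ⟩ := (isCompact_setOfPred_finiteMeasure_le_of_compactSpace
    (sphere (0 : CSpace d) 1) (F 0).re.toNNReal).ultrafilter_le_nhds
    ((Filter.hyperfilter ℕ).map ν) (by
      rw [Filter.le_principal_iff]
      exact Filter.mem_map.2 (Filter.univ_mem' hmass))
  have hσ' : Filter.Tendsto ν (Filter.hyperfilter ℕ) (nhds σ) := hσ
  rw [FiniteMeasure.tendsto_iff_forall_integral_rclike_tendsto ℂ] at hσ'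
  refine ⟨σ, inferInstance, fun z hz w hw => ?_⟩
  have h1 := hσ' (BoundedContinuousFunction.mkOfCompact ⟨_,
    (continuous_cauchyKernel_right (mem_ball_zero_iff.1 hz)).mul
      (continuous_cauchyKernel_left (mem_ball_zero_iff.1 hw))⟩)
  refine tendsto_nhds_unique h1 ?_
  change Filter.Tendsto (fun n => ∫ ζ : sphere (0 : CSpace d) 1,
    cauchyKernel z (ζ : CSpace d) * cauchyKernel (ζ : CSpace d) w ∂(ν n : Measure _)) _ _
  simp only [hkey _ z hz w hw]
  have h2 : ∀ x ∈ ball (0 : CSpace d) 1, Filter.Tendsto (fun n => F ((s n : ℂ) • x))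
      (Filter.hyperfilter ℕ) (nhds (F x)) := by
    intro x hx
    have h3 : Filter.Tendsto (fun n => (s n : ℂ) • x) (Filter.hyperfilter ℕ) (nhds x) := by
      have h4 := ((Complex.continuous_ofReal.tendsto 1).comp hs).smul_const x
      rw [Complex.ofReal_one, one_smul] at h4
      exact h4.mono_left Nat.hyperfilter_le_atTop
    exact ((hF.continuousOn.continuousAt (isOpen_ball.mem_nhds hx)).tendsto).comp h3
  exact (((h2 z hz).add ((Complex.continuous_conj.tendsto _).comp (h2 w hw))).div_const 2).mul_const _

end

/-! ### Uniqueness: the invariant Poisson kernel as an approximate identity -/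

section

variable {d : ℕ}

theorem invPoissonKernel_nonneg {z : CSpace d} (hz : ‖z‖ ≤ 1) (ζ : CSpace d) :
    0 ≤ invPoissonKernel z ζ := by
  unfold invPoissonKernel
  have : 0 ≤ 1 - ‖z‖ ^ 2 := by nlinarith [norm_nonneg z]
  positivity

theorem continuous_invPoissonKernel_smul {r : ℝ} (hr0 : 0 ≤ r) (hr : r < 1) :
    Continuous fun p : sphere (0 : CSpace d) 1 × sphere (0 : CSpace d) 1 =>
      invPoissonKernel ((r : ℂ) • (p.1 : CSpace d)) (p.2 : CSpace d) := by
  unfold invPoissonKernel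
  refine Continuous.pow (Continuous.div (by fun_prop) (by fun_prop) fun p => ?_) d
  refine pow_ne_zero _ (norm_ne_zero_iff.2 (one_sub_inner_ne_zero ?_))
  rw [norm_smul, Complex.norm_real, Real.norm_of_nonneg hr0, norm_eq_of_mem_sphere,
    norm_eq_of_mem_sphere]
  linarith

theorem invPoissonKernel_smul_comm (r : ℝ) (ζ η : sphere (0 : CSpace d) 1) :
    invPoissonKernel ((r : ℂ) • (ζ : CSpace d)) (η : CSpace d) =
      invPoissonKernel ((r : ℂ) • (η : CSpace d)) (ζ : CSpace d) := by
  unfold invPoissonKernel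
  have h : ‖(1 - inner ℂ (η : CSpace d) ((r : ℂ) • (ζ : CSpace d)) : ℂ)‖ =
      ‖(1 - inner ℂ (ζ : CSpace d) ((r : ℂ) • (η : CSpace d)) : ℂ)‖ := by
    rw [← RCLike.norm_conj]
    simp only [map_sub, map_one, inner_smul_right, map_mul, inner_conj_symm, Complex.conj_ofReal]
  rw [h, norm_smul, norm_smul, norm_eq_of_mem_sphere, norm_eq_of_mem_sphere]

theorem ofReal_integral_invPoissonKernel {μ : Measure (sphere (0 : CSpace d) 1)} {z : CSpace d}
    (hz : ‖z‖ < 1) {a : ℂ}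
    (h : ∫ ζ : sphere (0 : CSpace d) 1,
      cauchyKernel z (ζ : CSpace d) * cauchyKernel (ζ : CSpace d) z ∂μ = a * cauchyKernel z z) :
    (invPoissonIntegral μ z : ℂ) = a := by
  simp only [cauchyKernel_mul_cauchyKernel hz] at h
  rw [integral_mul_const, integral_complex_ofReal] at h
  exact mul_right_cancel₀ (cauchyKernel_self_ne_zero hz) h

theorem invPoissonIntegral_eq_one {τ : Measure (sphere (0 : CSpace d) 1)} [IsProbabilityMeasure τ]
    (hd : 0 < d) (hτ : IsUnitarilyInvariant τ) {z : CSpace d} (hz : ‖z‖ < 1) :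
    invPoissonIntegral τ z = 1 := by
  -- For constant `F` the dilation is immaterial, so `s = 0` is allowed.
  have h := integral_cauchyKernel_mul_holomorphic hd hτ (F := fun _ => 1)
    (differentiableOn_const _) le_rfl zero_lt_one hz hz
  simp only [one_mul] at h
  exact_mod_cast ofReal_integral_invPoissonKernel hz (a := 1) (by rw [h, one_mul])

/-- For unit vectors `⟨η, ζ⟩ = 1` only if `ζ = η`, so by compactness `|1 - ⟨η, ζ⟩| ≥ δ` off `u`.
Moving `η` to `ρη` costs at most `1 - ρ` in this bound, while the numerator `1 - ρ²` tends to `0`.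
-/
theorem tendstoUniformlyOn_invPoissonKernel (hd : 0 < d) {ρ : ℕ → ℝ} (hρ0 : ∀ n, 0 ≤ ρ n)
    (hρ1 : ∀ n, ρ n < 1) (hρ : Filter.Tendsto ρ Filter.atTop (nhds 1))
    (η : sphere (0 : CSpace d) 1) {u : Set (sphere (0 : CSpace d) 1)} (hu : IsOpen u)
    (hη : η ∈ u) :
    TendstoUniformlyOn (fun n (ζ : sphere (0 : CSpace d) 1) =>
      invPoissonKernel ((ρ n : ℂ) • (η : CSpace d)) (ζ : CSpace d)) 0 Filter.atTop uᶜ := by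
  have : ProperSpace (CSpace d) := FiniteDimensional.proper ℂ _
  obtain ⟨δ, hδ, hδu⟩ : ∃ δ : ℝ, 0 < δ ∧ ∀ ζ ∈ uᶜ,
      δ ≤ ‖(1 - inner ℂ (ζ : CSpace d) (η : CSpace d) : ℂ)‖ := by
    rcases (uᶜ).eq_empty_or_nonempty with he | hne
    · exact ⟨1, one_pos, by simp [he]⟩
    · obtain ⟨ζ₀, hζ₀, hmin⟩ := hu.isClosed_compl.isCompact.exists_isMinOn hne
        (f := fun ζ : sphere (0 : CSpace d) 1 =>
          ‖(1 - inner ℂ (ζ : CSpace d) (η : CSpace d) : ℂ)‖) (by fun_prop)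
      refine ⟨_, norm_pos_iff.2 fun h0 => ?_, fun ζ hζ => hmin hζ⟩
      have h1 : (inner ℂ (ζ₀ : CSpace d) (η : CSpace d) : ℂ) = 1 := (sub_eq_zero.1 h0).symm
      rw [inner_eq_one_iff_of_norm_eq_one (norm_eq_of_mem_sphere _) (norm_eq_of_mem_sphere _)] at h1
      exact hζ₀ (by rwa [Subtype.ext h1])
  have hbound : Filter.Tendsto (fun n => ((1 - ρ n ^ 2) / (δ - (1 - ρ n)) ^ 2) ^ d)
      Filter.atTop (nhds 0) := by
    have h1 : Filter.Tendsto (fun n => ((1 - ρ n ^ 2) / (δ - (1 - ρ n)) ^ 2) ^ d)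
        Filter.atTop (nhds (((1 - 1 ^ 2) / (δ - (1 - 1)) ^ 2) ^ d)) := by
      refine ((Filter.Tendsto.div ((hρ.pow 2).const_sub 1)
        (((hρ.const_sub 1).const_sub δ).pow 2) ?_).pow d)
      simp [hδ.ne']
    simpa [hd.ne'] using h1
  rw [Metric.tendstoUniformlyOn_iff]
  intro ε hε
  have hδ' : ∀ᶠ n in Filter.atTop, 1 - δ < ρ n := hρ.eventually (lt_mem_nhds (by linarith))
  filter_upwards [hbound.eventually (gt_mem_nhds hε), hδ'] with n hn hn' ζ hζ
  have hnorm : ‖(ρ n : ℂ) • (η : CSpace d)‖ = ρ n := by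
    rw [norm_smul, Complex.norm_real, Real.norm_of_nonneg (hρ0 n), norm_eq_of_mem_sphere, mul_one]
  rw [Pi.zero_apply, dist_zero_left, Real.norm_of_nonneg
    (invPoissonKernel_nonneg (by rw [hnorm]; exact (hρ1 n).le) _)]
  refine lt_of_le_of_lt ?_ hn
  unfold invPoissonKernel
  rw [hnorm]
  have h1 : 0 ≤ 1 - ρ n ^ 2 := by nlinarith [hρ0 n, hρ1 n]
  have h2 : δ - (1 - ρ n) ≤ ‖(1 - inner ℂ (ζ : CSpace d) ((ρ n : ℂ) • (η : CSpace d)) : ℂ)‖ := by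
    have h3 := norm_inner_le_norm (𝕜 := ℂ) (ζ : CSpace d) (η : CSpace d)
    rw [norm_eq_of_mem_sphere, norm_eq_of_mem_sphere, mul_one] at h3
    have h4 : (1 - inner ℂ (ζ : CSpace d) (η : CSpace d) : ℂ) =
        (1 - inner ℂ (ζ : CSpace d) ((ρ n : ℂ) • (η : CSpace d))) -
          ((1 - ρ n : ℝ) : ℂ) * inner ℂ (ζ : CSpace d) (η : CSpace d) := by
      rw [inner_smul_right]
      push_cast
      ring
    have h5 := hδu ζ hζ
    rw [h4] at h5
    have h6 := h5.trans (norm_sub_le _ _)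
    rw [norm_mul, Complex.norm_real, Real.norm_of_nonneg (by linarith [hρ1 n])] at h6
    have h7 : (1 - ρ n) * ‖(inner ℂ (ζ : CSpace d) (η : CSpace d) : ℂ)‖ ≤ 1 - ρ n :=
      mul_le_of_le_one_right (by linarith [hρ1 n]) h3
    linarith
  have h8 : 0 < δ - (1 - ρ n) := by linarith
  gcongr

/-- Fubini and the symmetry of `K` move the smoothing from `m` onto `f`. The smoothed functions
converge pointwise to `f` and are bounded by `‖f‖`, so dominated convergence applies for `m`. -/
theorem tendsto_integral_approximate_identity {X : Type*} [PseudoMetricSpace X] [CompactSpace X]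
    [SecondCountableTopology X] [MeasurableSpace X] [BorelSpace X] {τ m : Measure X}
    [IsProbabilityMeasure τ] [IsFiniteMeasure m] {K : ℕ → X → X → ℝ}
    (hK : ∀ n, Continuous (Function.uncurry (K n))) (hK0 : ∀ n x y, 0 ≤ K n x y)
    (hKsymm : ∀ n x y, K n x y = K n y x) (hKint : ∀ n x, ∫ y, K n x y ∂τ = 1)
    (hKpeak : ∀ x (u : Set X), IsOpen u → x ∈ u →
      TendstoUniformlyOn (fun n => K n x) 0 Filter.atTop uᶜ)
    (f : BoundedContinuousFunction X ℝ) :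
    Filter.Tendsto (fun n => ∫ x, (∫ y, K n x y ∂m) * f x ∂τ) Filter.atTop
      (nhds (∫ x, f x ∂m)) := by
  have hint : ∀ {Y : Type _} [TopologicalSpace Y] [CompactSpace Y] [MeasurableSpace Y]
      [OpensMeasurableSpace Y] {ρ : Measure Y} [IsFiniteMeasure ρ] {g : Y → ℝ},
      Continuous g → Integrable g ρ := fun hg =>
    hg.integrable_of_hasCompactSupport (HasCompactSupport.of_compactSpace _)
  have hKc : ∀ n x, Continuous (K n x) := fun n x => (hK n).comp (Continuous.prodMk_right x)
  have hswap : ∀ n, ∫ x, (∫ y, K n x y ∂m) * f x ∂τ = ∫ y, (∫ x, K n y x • f x ∂τ) ∂m := by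
    intro n
    simp only [← integral_mul_const]
    rw [integral_integral_swap]
    · refine integral_congr_ae (.of_forall fun y => ?_)
      refine integral_congr_ae (.of_forall fun x => ?_)
      simp only [hKsymm n x y, smul_eq_mul]
    · exact hint ((hK n).mul (f.continuous.comp continuous_fst))
  simp only [hswap]
  refine tendsto_integral_of_dominated_convergence (fun _ => ‖f‖) (fun n => ?_)
    (integrable_const _) (fun n => .of_forall fun y => ?_) (.of_forall fun y => ?_)
  · exact (hint ((hK n).mul (f.continuous.comp continuous_snd)) :
      Integrable _ (m.prod τ)).integral_prod_left.aestronglyMeasurable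
  · calc _ ≤ ∫ x, K n y x * ‖f‖ ∂τ := by
          refine norm_integral_le_of_norm_le ((hint (hKc n y)).mul_const _) (.of_forall fun x => ?_)
          rw [norm_smul, Real.norm_of_nonneg (hK0 n y x)]
          exact mul_le_mul_of_nonneg_left (f.norm_coe_le_norm x) (hK0 n y x)
      _ = ‖f‖ := by rw [integral_mul_const, hKint, one_mul]
  · refine tendsto_integral_peak_smul_of_integrable_of_tendsto (t := Set.univ) (x₀ := y)
      MeasurableSet.univ Filter.univ_mem (measure_ne_top _ _)
      (.of_forall fun n x => hK0 n y x) (fun u hu hy => hKpeak y u hu hy) ?_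
      (.of_forall fun n => (hKc n y).aestronglyMeasurable) (f.integrable τ)
      f.continuous.continuousAt
    refine tendsto_const_nhds.congr fun n => ?_
    rw [setIntegral_univ, hKint]

/-- A finite measure on the sphere is determined by its invariant Poisson integral. -/
theorem eq_of_invPoissonIntegral_eq (hd : 0 < d) {μ ν : Measure (sphere (0 : CSpace d) 1)}
    [IsFiniteMeasure μ] [IsFiniteMeasure ν]
    (h : ∀ z ∈ ball (0 : CSpace d) 1, invPoissonIntegral μ z = invPoissonIntegral ν z) :
    μ = ν := by
  have : ProperSpace (CSpace d) := FiniteDimensional.proper ℂ _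
  have : Nonempty (Fin d) := ⟨⟨0, hd⟩⟩
  obtain ⟨τ, hτp, hτ⟩ := exists_isUnitarilyInvariant (V := CSpace d)
  obtain ⟨s, hs0, hs1, hs⟩ := exists_seq_tendsto_one
  have hsmem : ∀ n (ζ : sphere (0 : CSpace d) 1), ‖(s n : ℂ) • (ζ : CSpace d)‖ < 1 := by
    intro n ζ
    rw [norm_smul, Complex.norm_real, Real.norm_of_nonneg (hs0 n), norm_eq_of_mem_sphere, mul_one]
    exact hs1 n
  refine ext_of_forall_integral_eq_of_IsFiniteMeasure fun f => ?_
  have key := fun (m : Measure (sphere (0 : CSpace d) 1)) [IsFiniteMeasure m] =>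
    tendsto_integral_approximate_identity (τ := τ) (m := m)
      (K := fun n (ζ η : sphere (0 : CSpace d) 1) =>
        invPoissonKernel ((s n : ℂ) • (ζ : CSpace d)) (η : CSpace d))
      (fun n => continuous_invPoissonKernel_smul (hs0 n) (hs1 n))
      (fun n ζ _ => invPoissonKernel_nonneg (hsmem n ζ).le _)
      (fun n => invPoissonKernel_smul_comm (s n))
      (fun n ζ => invPoissonIntegral_eq_one hd hτ (hsmem n ζ))
      (fun ζ u hu hζ => tendstoUniformlyOn_invPoissonKernel hd hs0 hs1 hs ζ hu hζ) f
  refine tendsto_nhds_unique (key μ) ?_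
  refine (key ν).congr fun n => ?_
  refine integral_congr_ae (.of_forall fun ζ => ?_)
  exact congrArg (· * f ζ) (h _ (mem_ball_zero_iff.2 (hsmem n ζ))).symm

end

/-! ### The Cayley transform `(α + x) / (α - x)` -/

section

variable {d : ℕ}

theorem sub_ne_zero_of_norm_lt_one {α x : ℂ} (hα : ‖α‖ = 1) (hx : ‖x‖ < 1) : α - x ≠ 0 := by
  intro h
  rw [← sub_eq_zero.1 h, hα] at hx
  exact lt_irrefl _ hx

theorem cayley_half_sum {α x y : ℂ} (hα : ‖α‖ = 1) (hx : ‖x‖ < 1) (hy : ‖y‖ < 1) :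
    ((α + x) / (α - x) + conj ((α + y) / (α - y))) / 2 =
      (1 - x * star y) / ((1 - star α * x) * (1 - α * star y)) := by
  have h1 := sub_ne_zero_of_norm_lt_one hα hx
  have hαα : α * conj α = 1 := by
    rw [Complex.mul_conj, Complex.normSq_eq_norm_sq, hα]
    simp
  have h2 : conj α - conj y ≠ 0 :=
    sub_ne_zero_of_norm_lt_one (by simpa using hα) (by simpa using hy)
  have e1 : 1 - conj α * x = conj α * (α - x) := by linear_combination -hαα
  have e2 : 1 - α * conj y = α * (conj α - conj y) := by linear_combination -hαα
  simp only [Complex.star_def, map_div₀, map_add, map_sub]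
  rw [e1, e2]
  rw [show conj α * (α - x) * (α * (conj α - conj y)) = (α - x) * (conj α - conj y) by
    linear_combination (α - x) * (conj α - conj y) * hαα]
  field_simp
  linear_combination 2 * hαα

theorem cayley_re_nonneg {α x : ℂ} (hα : ‖α‖ = 1) (hx : ‖x‖ < 1) :
    0 ≤ ((α + x) / (α - x)).re := by
  have h1 : ((α + x) / (α - x)).re = (‖α‖ ^ 2 - ‖x‖ ^ 2) / Complex.normSq (α - x) := by
    rw [Complex.div_re, ← add_div, ← Complex.normSq_eq_norm_sq, ← Complex.normSq_eq_norm_sq]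
    congr 1
    simp only [Complex.normSq_apply, Complex.add_re, Complex.sub_re, Complex.add_im, Complex.sub_im]
    ring
  rw [h1, hα]
  exact div_nonneg (by nlinarith [norm_nonneg x]) (Complex.normSq_nonneg _)

end

theorem mainTheorem12 (d : ℕ) (hd : 2 ≤ d) (φ : CSpace d → ℂ)
    (hφ : DifferentiableOn ℂ φ (ball (0 : CSpace d) 1))
    (hφ_maps : Set.MapsTo φ (ball (0 : CSpace d) 1) (ball (0 : ℂ) 1))
    (α : ℂ) (hα : ‖α‖ = 1) :
    (∃! σ : Measure (sphere (0 : CSpace d) 1), IsClarkMeasure φ α σ) ∧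
    ∀ σ : Measure (sphere (0 : CSpace d) 1), IsClarkMeasure φ α σ →
      ∀ z ∈ ball (0 : CSpace d) 1, ∀ w ∈ ball (0 : CSpace d) 1,
        Integrable (fun ζ : sphere (0 : CSpace d) 1 =>
          cauchyKernel z (ζ : CSpace d) * cauchyKernel (ζ : CSpace d) w) σ ∧
        ∫ ζ : sphere (0 : CSpace d) 1,
            cauchyKernel z (ζ : CSpace d) * cauchyKernel (ζ : CSpace d) w ∂σ =
          (1 - φ z * star (φ w)) /
              ((1 - star α * φ z) * (1 - α * star (φ w))) *
            cauchyKernel z w := by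
  have hd0 : 0 < d := by omega
  have hlt : ∀ z ∈ ball (0 : CSpace d) 1, ‖φ z‖ < 1 := fun z hz =>
    mem_ball_zero_iff.1 (hφ_maps hz)
  obtain ⟨σ₀, hfin, hσ₀⟩ := exists_measure_integral_cauchyKernel hd0
    (F := fun z => (α + φ z) / (α - φ z))
    (by
      simp only [div_eq_mul_inv]
      exact (hφ.const_add α).mul ((hφ.const_sub α).fun_inv fun z hz =>
        sub_ne_zero_of_norm_lt_one hα (hlt z hz)))
    fun z hz => cayley_re_nonneg hα (hlt z hz)
  -- The diagonal `w = z` of the two-kernel formula, where the half-sum is the real part.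
  have hclark : IsClarkMeasure φ α σ₀ := by
    refine ⟨hfin, fun z hz => ?_⟩
    have h1 := ofReal_integral_invPoissonKernel (mem_ball_zero_iff.1 hz) (hσ₀ z hz z hz)
    rw [← Complex.re_eq_add_conj] at h1
    exact_mod_cast h1
  have huniq : ∀ σ, IsClarkMeasure φ α σ → σ = σ₀ := by
    intro σ hσ
    have := hσ.finite
    exact eq_of_invPoissonIntegral_eq hd0 fun z hz => by rw [hσ.poisson z hz, hclark.poisson z hz]
  refine ⟨⟨σ₀, hclark, huniq⟩, fun σ hσ z hz w hw => ?_⟩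
  -- The formula is known for the constructed measure; uniqueness transfers it to any Clark measure.
  rw [huniq σ hσ]
  refine ⟨Continuous.integrable_sphere ((continuous_cauchyKernel_right (mem_ball_zero_iff.1 hz)).mul
    (continuous_cauchyKernel_left (mem_ball_zero_iff.1 hw))), ?_⟩
  rw [hσ₀ z hz w hw, cayley_half_sum hα (hlt z hz) (hlt w hw)]
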